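/- Let $G$ be a group with a finite generating set $S$. For $\lambda\in(0,1)$, the Floyd metric $\boldsymbol\delta_{S,\lambda}$ on $G$ is the path metric of the Cayley graph of $(G,S)$ (with $G$ acting by left multiplication) in which an edge $e$ has length $\lambda^{n}$, where $n$ is the distance from $1$ to $e$ in the Cayley graph. The Floyd boundary $\partial_\lambda G=\overline G\setminus G$ is the complement of $G$ in the Cauchy completion $\overline G$ of $(G,\boldsymbol\delta_{S,\lambda})$; it carries the natural action of $G$. An action of the discrete group $G$ by homeomorphisms on a compact Hausdorff space $T$ with at least three points is called relatively hyperbolic if it is proper on the space of triples of distinct points, cocompact on the space of pairs of distinct points, and has at least two limit points. Here, for $E\subset G$, a pair $(r,a)\in T^2$ is called a limit pair of $E$, with repeller $r$ and attractor $a$, if for all neighborhoods $U$ of $r$ and $V$ of $a$ one has $g(T\setminus U)\subset V$ for infinitely many $g\in E$; the limit points are the attractors of the limit pairs of $G$, and they form the limit set $\Lambda G\subset T$. An infinite set $E\subset G$ is a cone if no attractor of $E$ lies in the closure of $\{gr : g\in E,\ r \text{ a repeller of } E\}$; a point is conical if it is a repeller of some cone. The group $G$ is relatively hyperbolic with respect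 to a finite collection $\mathcal P$ of infinite subgroups if it possesses a relatively hyperbolic action on some $T$ such that $\mathcal P$ is a set of representatives of the conjugacy classes of the stabilizers of the non-conical limit points. The limit set $\Lambda G$ of such an action, with the subspace topology and the action of $G$, is the Bowditch boundary of $G$ with respect to $\mathcal P$. Corollary. Let $G$ be a group with a finite generating set $S$ that is relatively hyperbolic with respect to a finite collection $\mathcal P$ of infinite subgroups. Then, for every $T$ as above, there exist $\lambda\in(0,1)$ and a continuous $G$-equivariant map from the Floyd boundary $\partial_\lambda G$ to the Bowditch boundary $\Lambda G\subset T$ of $G$ with respect to $\mathcal P$. -/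

import Mathlib

open scoped ENNReal NNReal Topology

/-- A finite generating set of a group. -/
structure FiniteGeneratingSet (G : Type*) [Group G] where
  carrier : Finset G
  closure_eq_top : Subgroup.closure (carrier : Set G) = ⊤

namespace FiniteGeneratingSet

variable {G : Type*} [Group G] (S : FiniteGeneratingSet G)

/-- The Cayley graph: `x ≠ y` are joined by an edge when `x * s = y` or `y * s = x` for some
`s ∈ S`. The group acts on it by left multiplication. -/
abbrev cayleyGraph : SimpleGraph G := SimpleGraph.mulCayley (S.carrier : Set G)

/-- Left multiplication as an automorphism of the Cayley graph. -/
def leftMul (g : G) : S.cayleyGraph ≃g S.cayleyGraph where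
  toEquiv := Equiv.mulLeft g
  map_rel_iff' := by
    intro a b
    simp

lemma reachable_one (x : G) : S.cayleyGraph.Reachable 1 x := by
  have hx : x ∈ Subgroup.closure (S.carrier : Set G) := by
    rw [S.closure_eq_top]; exact Subgroup.mem_top x
  induction hx using Subgroup.closure_induction with
  | mem s hs =>
    by_cases h : (1 : G) = s
    · subst h; exact SimpleGraph.Reachable.refl _
    · refine SimpleGraph.Adj.reachable ?_
      rw [SimpleGraph.mulCayley_adj']
      exact ⟨h, s, hs, Or.inl (one_mul s)⟩
  | one => exact SimpleGraph.Reachable.refl _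
  | mul a b _ _ ha hb =>
    have h : S.cayleyGraph.Reachable (S.leftMul a 1) (S.leftMul a b) :=
      hb.map (S.leftMul a).toHom
    have h1 : S.leftMul a 1 = a := mul_one a
    have h2 : S.leftMul a b = a * b := rfl
    rw [h1, h2] at h
    exact ha.trans h
  | inv a _ ha =>
    have h : S.cayleyGraph.Reachable (S.leftMul a⁻¹ 1) (S.leftMul a⁻¹ a) :=
      ha.map (S.leftMul a⁻¹).toHom
    have h1 : S.leftMul a⁻¹ 1 = a⁻¹ := mul_one a⁻¹
    have h2 : S.leftMul a⁻¹ a = 1 := inv_mul_cancel a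
    rw [h1, h2] at h
    exact h.symm

lemma connected : S.cayleyGraph.Connected :=
  { preconnected := fun x y => (S.reachable_one x).symm.trans (S.reachable_one y)
    nonempty := ⟨1⟩ }

/-- The word length of `x`: the distance from `1` to `x` in the Cayley graph. -/
noncomputable def wordLength (x : G) : ℕ := S.cayleyGraph.dist 1 x

lemma wordLength_le (g x : G) : S.wordLength x ≤ S.wordLength g + S.wordLength (g * x) := by
  obtain ⟨p, hp⟩ := S.connected.exists_walk_length_eq_dist g (g * x)
  have h1 : S.leftMul g⁻¹ g = 1 := inv_mul_cancel g
  have h2 : S.leftMul g⁻¹ (g * x) = x := inv_mul_cancel_left g x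
  have h : S.cayleyGraph.dist (S.leftMul g⁻¹ g) (S.leftMul g⁻¹ (g * x)) ≤
      (p.map (S.leftMul g⁻¹).toHom).length := SimpleGraph.dist_le _
  rw [h1, h2, SimpleGraph.Walk.length_map, hp] at h
  have h3 := S.connected.dist_triangle (u := g) (v := 1) (w := g * x)
  rw [SimpleGraph.dist_comm (u := g) (v := 1)] at h3
  exact h.trans h3

/-- The Floyd length of the edge `{x, y}`: `lam ^ n`, with `n` the distance in the Cayley graph
from the vertex `1` to the edge. -/
noncomputable def floydEdgeLength (lam : Set.Ioo (0 : ℝ) 1) (x y : G) : ℝ≥0∞ :=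
  ENNReal.ofReal ((lam : ℝ) ^ min (S.wordLength x) (S.wordLength y))

lemma floydEdgeLength_comm (lam : Set.Ioo (0 : ℝ) 1) (x y : G) :
    S.floydEdgeLength lam x y = S.floydEdgeLength lam y x := by
  rw [floydEdgeLength, floydEdgeLength, min_comm]

/-- The Floyd length of a path: the sum of the Floyd lengths of its edges. -/
noncomputable def floydWalkLength (lam : Set.Ioo (0 : ℝ) 1) {x y : G}
    (p : S.cayleyGraph.Walk x y) : ℝ≥0∞ :=
  (p.darts.map fun d => S.floydEdgeLength lam d.fst d.snd).sum

/-- The constant `lam⁻¹ ^ |g|`. -/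
noncomputable def lipConst (lam : Set.Ioo (0 : ℝ) 1) (g : G) : ℝ≥0 :=
  Real.toNNReal ((lam : ℝ)⁻¹ ^ S.wordLength g)

lemma floydEdgeLength_mul_le (lam : Set.Ioo (0 : ℝ) 1) (g x y : G) :
    S.floydEdgeLength lam (g * x) (g * y) ≤ S.lipConst lam g * S.floydEdgeLength lam x y := by
  obtain ⟨l, h0, h1⟩ := lam
  have hC : (0 : ℝ) ≤ l⁻¹ ^ S.wordLength g := by positivity
  show ENNReal.ofReal (l ^ _) ≤ ENNReal.ofReal (l⁻¹ ^ _) * ENNReal.ofReal (l ^ _)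
  rw [← ENNReal.ofReal_mul hC]
  refine ENNReal.ofReal_le_ofReal ?_
  rw [inv_pow, inv_mul_eq_div, le_div_iff₀ (pow_pos h0 _), ← pow_add]
  refine pow_le_pow_of_le_one h0.le h1.le ?_
  have hx := S.wordLength_le g x
  have hy := S.wordLength_le g y
  omega

/-- The Floyd distance of `x` and `y`: the infimum of the Floyd lengths of the paths from `x` to
`y` in the Cayley graph. -/
noncomputable def floydEDist (lam : Set.Ioo (0 : ℝ) 1) (x y : G) : ℝ≥0∞ :=
  ⨅ p : S.cayleyGraph.Walk x y, S.floydWalkLength lam p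

lemma floydEDist_self (lam : Set.Ioo (0 : ℝ) 1) (x : G) : S.floydEDist lam x x = 0 := by
  refine nonpos_iff_eq_zero.1 (iInf_le_of_le SimpleGraph.Walk.nil ?_)
  simp [floydWalkLength]

lemma floydEDist_le_swap (lam : Set.Ioo (0 : ℝ) 1) (x y : G) :
    S.floydEDist lam x y ≤ S.floydEDist lam y x := by
  refine le_iInf fun p => iInf_le_of_le p.reverse (le_of_eq ?_)
  simp only [floydWalkLength, SimpleGraph.Walk.darts_reverse, List.map_reverse, List.sum_reverse,
    List.map_map]
  congr 1
  refine List.map_congr_left fun d _ => ?_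
  exact S.floydEdgeLength_comm lam _ _

lemma floydEDist_triangle (lam : Set.Ioo (0 : ℝ) 1) (x y z : G) :
    S.floydEDist lam x z ≤ S.floydEDist lam x y + S.floydEDist lam y z := by
  refine ENNReal.le_iInf_add_iInf fun p q => ?_
  refine iInf_le_of_le (p.append q) (le_of_eq ?_)
  simp [floydWalkLength, SimpleGraph.Walk.darts_append]

lemma floydEDist_mul_le (lam : Set.Ioo (0 : ℝ) 1) (g x y : G) :
    S.floydEDist lam (g * x) (g * y) ≤ S.lipConst lam g * S.floydEDist lam x y := by
  have hC : S.lipConst lam g ≠ 0 :=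
    (Real.toNNReal_pos.2 (pow_pos (inv_pos.2 lam.2.1) _)).ne'
  rw [floydEDist, floydEDist, ENNReal.mul_iInf_of_ne (ENNReal.coe_ne_zero.2 hC)
    ENNReal.coe_ne_top]
  refine le_iInf fun p => ?_
  refine (iInf_le (fun p : S.cayleyGraph.Walk (g * x) (g * y) => S.floydWalkLength lam p)
    (p.map (S.leftMul g).toHom)).trans ?_
  induction p with
  | nil => exact bot_le
  | @cons u v w h p ih =>
    have h1 := S.floydEdgeLength_mul_le lam g u v
    simp only [floydWalkLength, SimpleGraph.Walk.map_cons, SimpleGraph.Walk.darts_cons,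
      List.map_cons, List.sum_cons, mul_add] at ih ⊢
    exact add_le_add h1 ih

end FiniteGeneratingSet

/-- The group `G` equipped with the Floyd metric with scaling function `n ↦ lam ^ n`. -/
def FloydGroup {G : Type*} [Group G] (_S : FiniteGeneratingSet G) (_lam : Set.Ioo (0 : ℝ) 1) :
    Type _ := G

namespace FloydGroup

variable {G : Type*} [Group G] (S : FiniteGeneratingSet G) (lam : Set.Ioo (0 : ℝ) 1)

/-- `G` acts on itself by left multiplication. -/
instance : MulAction G (FloydGroup S lam) := inferInstanceAs (MulAction G G)

/-- The Floyd metric on `G`. -/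
noncomputable instance : PseudoEMetricSpace (FloydGroup S lam) where
  edist x y := S.floydEDist lam x y
  edist_self x := S.floydEDist_self lam x
  edist_comm x y := le_antisymm (S.floydEDist_le_swap lam x y) (S.floydEDist_le_swap lam y x)
  edist_triangle x y z := S.floydEDist_triangle lam x y z

/-- The action of `G` on itself is by Lipschitz maps of the Floyd metric, so it extends to the
completion. -/
instance : UniformContinuousConstSMul G (FloydGroup S lam) where
  uniformContinuous_const_smul g :=
    (show LipschitzWith (S.lipConst lam g) (fun x : FloydGroup S lam => g • x) from
      S.floydEDist_mul_le lam g).uniformContinuous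

end FloydGroup

/-- The Floyd boundary: the complement of `G` in the Cauchy completion of `G` with respect to the
Floyd metric, as a `G`-invariant subspace of the completion. -/
noncomputable def FloydBoundary {G : Type*} [Group G] (S : FiniteGeneratingSet G)
    (lam : Set.Ioo (0 : ℝ) 1) :
    SubMulAction G (UniformSpace.Completion (FloydGroup S lam)) where
  carrier := (Set.range ((↑) : FloydGroup S lam → UniformSpace.Completion (FloydGroup S lam)))ᶜ
  smul_mem' := by
    rintro g x hx ⟨y, hy⟩
    refine hx ⟨g⁻¹ • y, ?_⟩
    rw [UniformSpace.Completion.coe_smul, hy, inv_smul_smul]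

/-! ### Convergence actions of discrete groups -/

/-- The action of the discrete group `G` on the space of triples of distinct points of `T` is
proper. -/
def IsProperOnTriples (G T : Type*) [Group G] [TopologicalSpace T] [MulAction G T] : Prop :=
  ∀ K : Set (T × T × T), IsCompact K →
    (∀ p ∈ K, p.1 ≠ p.2.1 ∧ p.1 ≠ p.2.2 ∧ p.2.1 ≠ p.2.2) →
      {g : G | ∃ p ∈ K, g • p ∈ K}.Finite

/-- The action of `G` on the space of pairs of distinct points of `T` is cocompact. -/
def IsCocompactOnPairs (G T : Type*) [Group G] [TopologicalSpace T] [MulAction G T] : Prop :=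
  ∃ K : Set (T × T), IsCompact K ∧ (∀ p ∈ K, p.1 ≠ p.2) ∧
    ∀ p : T × T, p.1 ≠ p.2 → ∃ g : G, g • p ∈ K

section LimitSets

variable {G T : Type*} [Group G] [TopologicalSpace T] [MulAction G T]

/-- `(r, a)` is the center (repeller, attractor) of a limit cross of `E ⊆ G`: for all neighborhoods
`U` of `r` and `V` of `a`, infinitely many elements of `E` map the complement of `U` into `V`. -/
def IsLimitCross (E : Set G) (r a : T) : Prop :=
  ∀ U ∈ 𝓝 r, ∀ V ∈ 𝓝 a, {g ∈ E | ∀ x ∉ U, g • x ∈ V}.Infinite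

/-- The set of repellers of the limit crosses of `E`. -/
def repellingSet (E : Set G) : Set T := {r | ∃ a : T, IsLimitCross E r a}

/-- The set of attractors of the limit crosses of `E`. -/
def attractingSet (E : Set G) : Set T := {a | ∃ r : T, IsLimitCross E r a}

/-- An infinite set `E ⊆ G` is a cone if its attracting set is disjoint from the closure of
`{g • r | g ∈ E, r a repeller of E}`. -/
def IsCone (T : Type*) [TopologicalSpace T] [MulAction G T] (E : Set G) : Prop :=
  E.Infinite ∧
    Disjoint (attractingSet E : Set T) (closure {x : T | ∃ g ∈ E, ∃ r ∈ repellingSet E, g • r = x})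

/-- A point is conical if it is the vertex of a cone, i.e. the (unique) repeller of a cone. -/
def IsConical (G : Type*) {T : Type*} [Group G] [TopologicalSpace T] [MulAction G T]
    (p : T) : Prop :=
  ∃ E : Set G, IsCone T E ∧ p ∈ (repellingSet E : Set T)

/-- The limit set of the action of `G` on `T`. -/
def limitSet (G T : Type*) [Group G] [TopologicalSpace T] [MulAction G T] : Set T :=
  attractingSet (Set.univ : Set G)

end LimitSets

/-- A relatively hyperbolic action of the discrete group `G` on the compactum `T`: a convergence
action (on a space with at least three points) that is cocompact on pairs and has at least two
limit points. -/
structure IsRelHypAction (G T : Type*) [Group G] [TopologicalSpace T] [MulAction G T] : Prop where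
  compactSpace : CompactSpace T
  t2Space : T2Space T
  continuous_smul : ∀ g : G, Continuous fun x : T => g • x
  three_points : ∃ x y z : T, x ≠ y ∧ x ≠ z ∧ y ≠ z
  proper : IsProperOnTriples G T
  cocompact : IsCocompactOnPairs G T
  limit_points : (limitSet G T).Nontrivial

/-- The action of `G` on `T` makes `G` relatively hyperbolic with respect to `P`: the action is
relatively hyperbolic and `P` is a finite collection of infinite subgroups which represents the
conjugacy classes of the stabilizers of the non-conical limit points. -/
structure IsRelHypActionWithPeripherals (G T : Type*) [Group G] [TopologicalSpace T]
    [MulAction G T] (P : Set (Subgroup G)) : Prop where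
  relHyp : IsRelHypAction G T
  finite : P.Finite
  infinite : ∀ H ∈ P, Infinite H
  exists_point : ∀ H ∈ P, ∃ p ∈ limitSet G T, ¬ IsConical G p ∧ MulAction.stabilizer G p = H
  existsUnique_conj : ∀ p ∈ limitSet G T, ¬ IsConical G p →
    ∃! H : Subgroup G, H ∈ P ∧
      ∃ g : G, MulAction.stabilizer G p = H.map (MulAut.conj g).toMonoidHom

/-- The Bowditch boundary of a group `G` that is relatively hyperbolic with respect to `P`, in the
model given by an action on `T` satisfying `IsRelHypActionWithPeripherals G T P`: the limit set
of `G` in `T`, with the subspace topology. -/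
abbrev bowditchBoundary (G T : Type*) [Group G] [TopologicalSpace T] [MulAction G T] : Set T :=
  limitSet G T

/-! Fix three distinct points `x j` of `T`. Group elements going to infinity are sent to `T` by
majority: `g` is near `a` when at least two of the points `g • x j` are near `a`. Properness on
triples makes every ultrafilter on `G` that goes to infinity carry all of `T`, except at most one
point, to a single limit point, so such majority limits exist; the allowed exception is why three
points are taken.

Cocompactness on pairs gives a neighborhood `W` of the diagonal out of which `G` moves every pair of
distinct points. It induces the relation `MajorityClose` on `G`, with two finiteness properties:
three steps that are close after translation by a certain finite set `F` compose to one close step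
(`exists_divider`), and all but finitely many edges with a given label are close
(`finite_not_majorityClose_mul`).

Let `escapeSize g h` be the supremum of `lam ^ |k|` over the `k` that make `(k * g, k * h)` not
close. For `lam` near `1` the first property is Frink's inequality, so `escapeSize` is comparable to
a pseudometric; the second bounds that pseudometric on edges, hence everywhere, by a multiple of the
Floyd metric. Thus, for each `k`, sufficiently Floyd-close elements remain `MajorityClose` after
translation by `k` (`exists_floydEDist_lt`). Two different majority limits at one Floyd boundary
point would be moved out of `W` by some `k`, a contradiction. So the limit is unique, which yields
the map, its continuity and its equivariance. -/

open Filter Set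

/-! ### The convergence property along ultrafilters -/

section Convergence

variable {G T : Type*} [Group G] [TopologicalSpace T] [MulAction G T]

/-- Properness on triples, in terms of filters: group elements going to infinity cannot carry
triples converging to a triple of distinct points to triples converging to such a triple. -/
lemma IsProperOnTriples.not_tendsto [CompactSpace T] [T2Space T] (hG : IsProperOnTriples G T)
    {l : Filter G} [l.NeBot] (hl : l ≤ cofinite) {p : G → T × T × T} {q q' : T × T × T}
    (hq : q.1 ≠ q.2.1 ∧ q.1 ≠ q.2.2 ∧ q.2.1 ≠ q.2.2)
    (hq' : q'.1 ≠ q'.2.1 ∧ q'.1 ≠ q'.2.2 ∧ q'.2.1 ≠ q'.2.2)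
    (hp : Tendsto p l (𝓝 q)) (hp' : Tendsto (fun g => g • p g) l (𝓝 q')) : False := by
  set D : Set (T × T × T) := {q | q.1 ≠ q.2.1 ∧ q.1 ≠ q.2.2 ∧ q.2.1 ≠ q.2.2}
  have hDo : IsOpen D := by
    refine IsOpen.inter ?_ (IsOpen.inter ?_ ?_)
    · exact isOpen_ne_fun continuous_fst (continuous_fst.comp continuous_snd)
    · exact isOpen_ne_fun continuous_fst (continuous_snd.comp continuous_snd)
    · exact isOpen_ne_fun (continuous_fst.comp continuous_snd)
        (continuous_snd.comp continuous_snd)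
  obtain ⟨K, hK, hqK, hKD⟩ := exists_compact_subset hDo (show q ∈ D from hq)
  obtain ⟨K', hK', hqK', hKD'⟩ := exists_compact_subset hDo (show q' ∈ D from hq')
  have hfin := hG (K ∪ K') (hK.union hK') (union_subset hKD hKD')
  have h1 := hp.eventually_mem (mem_interior_iff_mem_nhds.1 hqK)
  have h2 := hp'.eventually_mem (mem_interior_iff_mem_nhds.1 hqK')
  obtain ⟨g, h1, h2, h3⟩ := (h1.and (h2.and (hl hfin.compl_mem_cofinite))).exists
  exact h3 ⟨p g, Or.inl h1, Or.inr h2⟩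

/-- The pointwise convergence property: an ultrafilter on `G` that goes to infinity carries all
points of `T`, with at most one exception, to the same point. -/
lemma IsRelHypAction.exists_subsingleton_not_tendsto (h : IsRelHypAction G T)
    {𝒰 : Ultrafilter G} (h𝒰 : (𝒰 : Filter G) ≤ cofinite) :
    ∃ a : T, {y : T | ¬ Tendsto (fun g : G => g • y) 𝒰 (𝓝 a)}.Subsingleton := by
  have := h.compactSpace
  have := h.t2Space
  have hlim : ∀ u : G → T, ∃ z, Tendsto u 𝒰 (𝓝 z) := fun u =>
    ⟨_, (𝒰.map u).le_nhds_lim⟩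
  choose f hf using fun y : T => hlim fun g => g • y
  have triple : ∀ y₁ y₂ y₃, f y₁ ≠ f y₂ → f y₁ ≠ f y₃ → f y₂ ≠ f y₃ → False := by
    intro y₁ y₂ y₃ h₁ h₂ h₃
    refine h.proper.not_tendsto h𝒰 (p := fun _ => (y₁, y₂, y₃)) (q := (y₁, y₂, y₃))
      (q' := (f y₁, f y₂, f y₃)) ⟨?_, ?_, ?_⟩ ⟨h₁, h₂, h₃⟩ tendsto_const_nhds
      ((hf y₁).prodMk_nhds ((hf y₂).prodMk_nhds (hf y₃)))
    · exact fun e => h₁ (congrArg f e)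
    · exact fun e => h₂ (congrArg f e)
    · exact fun e => h₃ (congrArg f e)
  obtain ⟨x₀, x₁, x₂, h₀₁, h₀₂, h₁₂⟩ := h.three_points
  -- At most one fiber of `f` has more than one point. Given two such fibers, take a third value
  -- `c`, let `z` be the limit of `g⁻¹ • c`, and choose `y`, `y'` in the fibers away from `z`: the
  -- distinct triple `(y, y', z)` would go to the distinct triple `(f y, f y', c)`.
  have four : ∀ y₁ y₂ y₃ y₄, y₁ ≠ y₂ → y₃ ≠ y₄ → f y₁ = f y₂ → f y₃ = f y₄ → f y₁ = f y₃ := by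
    intro y₁ y₂ y₃ y₄ h₁₂' h₃₄ e₁ e₂
    by_contra hne
    obtain ⟨c, hc₁, hc₃⟩ : ∃ c, f y₁ ≠ c ∧ f y₃ ≠ c := by
      by_contra! hc
      have a₀ := or_iff_not_imp_left.2 (hc x₀)
      have a₁ := or_iff_not_imp_left.2 (hc x₁)
      have a₂ := or_iff_not_imp_left.2 (hc x₂)
      clear hf hc triple
      grind
    obtain ⟨z, hz⟩ := hlim fun g => g⁻¹ • c
    obtain ⟨y, hy, hyz⟩ : ∃ y, f y = f y₁ ∧ y ≠ z := by
      by_cases hz₁ : y₁ = z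
      · exact ⟨y₂, e₁.symm, fun h => h₁₂' (hz₁.trans h.symm)⟩
      · exact ⟨y₁, rfl, hz₁⟩
    obtain ⟨y', hy', hyz'⟩ : ∃ y, f y = f y₃ ∧ y ≠ z := by
      by_cases hz₁ : y₃ = z
      · exact ⟨y₄, e₂.symm, fun h => h₃₄ (hz₁.trans h.symm)⟩
      · exact ⟨y₃, rfl, hz₁⟩
    refine h.proper.not_tendsto h𝒰 (p := fun g => (y, y', g⁻¹ • c)) (q := (y, y', z))
      (q' := (f y, f y', c)) ⟨?_, hyz, hyz'⟩ ⟨?_, ?_, ?_⟩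
      (tendsto_const_nhds.prodMk_nhds (tendsto_const_nhds.prodMk_nhds hz))
      ((hf y).prodMk_nhds ((hf y').prodMk_nhds ?_))
    · exact fun e => hne (hy.symm.trans ((congrArg f e).trans hy'))
    · change f y ≠ f y'; rwa [hy, hy']
    · change f y ≠ c; rwa [hy]
    · change f y' ≠ c; rwa [hy']
    · simp
  have key : ∀ p q, p ≠ q → f p = f q →
      ∃ a : T, {y : T | ¬ Tendsto (fun g : G => g • y) 𝒰 (𝓝 a)}.Subsingleton := by
    intro p q hpq e
    have hne : ∀ y, ¬ Tendsto (fun g : G => g • y) 𝒰 (𝓝 (f p)) → f y ≠ f p := by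
      intro y hy e'
      exact hy (e' ▸ hf y)
    refine ⟨f p, fun y hy y' hy' => ?_⟩
    by_contra hyy
    by_cases e' : f y = f y'
    · exact hne y hy (four y y' p q hyy hpq e' e)
    · exact triple p y y' (hne y hy).symm (hne y' hy').symm e'
  by_cases e₀₁ : f x₀ = f x₁
  · exact key _ _ h₀₁ e₀₁
  by_cases e₀₂ : f x₀ = f x₂
  · exact key _ _ h₀₂ e₀₂
  by_cases e₁₂ : f x₁ = f x₂
  · exact key _ _ h₁₂ e₁₂
  exact (triple _ _ _ e₀₁ e₀₂ e₁₂).elim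

/-- A space with an action that is proper on triples is infinite if the group is. -/
lemma IsRelHypAction.infinite_space (h : IsRelHypAction G T) [Infinite G] : Infinite T := by
  by_contra hT
  have := not_infinite_iff_finite.1 hT
  obtain ⟨x, y, z, hxy, hxz, hyz⟩ := h.three_points
  refine Set.infinite_univ (α := G) ((h.proper
    {q | q.1 ≠ q.2.1 ∧ q.1 ≠ q.2.2 ∧ q.2.1 ≠ q.2.2} (Set.toFinite _).isCompact
    fun _ hp => hp).subset fun g _ => ⟨(x, y, z), ⟨hxy, hxz, hyz⟩, ?_⟩)
  exact ⟨fun e => hxy (MulAction.injective g e), fun e => hxz (MulAction.injective g e),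
    fun e => hyz (MulAction.injective g e)⟩

/-- The convergence property: if an ultrafilter that goes to infinity carries all points but at
most one to `a`, and its inverse carries all points but at most one to `r`, then it converges to
`a` uniformly outside the neighborhoods of `r`. -/
lemma IsRelHypAction.eventually_smul_mem (h : IsRelHypAction G T)
    {𝒰 : Ultrafilter G} (h𝒰 : (𝒰 : Filter G) ≤ cofinite) {a r : T}
    (ha : {y : T | ¬ Tendsto (fun g : G => g • y) 𝒰 (𝓝 a)}.Subsingleton)
    (hr : {y : T | ¬ Tendsto (fun g : G => g⁻¹ • y) 𝒰 (𝓝 r)}.Subsingleton)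
    {U V : Set T} (hU : U ∈ 𝓝 r) (hV : V ∈ 𝓝 a) :
    ∀ᶠ g in (𝒰 : Filter G), ∀ y ∉ U, g • y ∈ V := by
  have := h.compactSpace
  have := h.t2Space
  have : Infinite G := by
    by_contra hG
    have := not_infinite_iff_finite.1 hG
    rw [cofinite_eq_bot] at h𝒰
    exact 𝒰.neBot.ne (le_bot_iff.1 h𝒰)
  have := h.infinite_space
  have hlim : ∀ u : G → T, ∃ z, Tendsto u 𝒰 (𝓝 z) := fun u =>
    ⟨_, (𝒰.map u).le_nhds_lim⟩
  by_contra hcon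
  rw [← Ultrafilter.eventually_not] at hcon
  push Not at hcon
  obtain ⟨u, hu⟩ : ∃ u : G → T, ∀ᶠ g in (𝒰 : Filter G), u g ∉ U ∧ g • u g ∉ V := by
    classical
    refine ⟨fun g => if hg : ∃ y ∉ U, g • y ∉ V then hg.choose else a, ?_⟩
    filter_upwards [hcon] with g hg
    rw [dif_pos hg]
    exact hg.choose_spec
  obtain ⟨y, hy⟩ := hlim u
  obtain ⟨b, hb⟩ := hlim fun g => g • u g
  have hyr : y ≠ r := by
    rintro rfl
    obtain ⟨g, h1, h2⟩ := ((hy.eventually_mem hU).and hu).exists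
    exact h2.1 h1
  have hba : b ≠ a := by
    rintro rfl
    obtain ⟨g, h1, h2⟩ := ((hb.eventually_mem hV).and hu).exists
    exact h2.2 h1
  have avoid : ∀ (s : Set T) (c d : T), s.Subsingleton → ∃ w, w ∉ s ∧ w ≠ c ∧ w ≠ d := by
    intro s c d hs
    obtain ⟨w, hw⟩ := (hs.finite.union (Set.toFinite {c, d})).exists_notMem
    simp only [mem_union, mem_insert_iff, mem_singleton_iff, not_or] at hw
    exact ⟨w, hw⟩
  -- The generic points `w` and `w'` complete a forbidden triple: `(w, u g, g⁻¹ • w')` tends to `(w,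
  -- y, r)` and its image to `(a, b, w')`.
  obtain ⟨w, hw, hwy, hwr⟩ := avoid _ y r ha
  obtain ⟨w', hw', hwb', hwa'⟩ := avoid _ b a hr
  simp only [mem_ofPred_eq, not_not] at hw hw'
  refine h.proper.not_tendsto h𝒰 (p := fun g => (w, u g, g⁻¹ • w')) (q := (w, y, r))
    (q' := (a, b, w')) ⟨hwy, hwr, hyr⟩ ⟨hba.symm, hwa'.symm, hwb'.symm⟩
    (tendsto_const_nhds.prodMk_nhds (hy.prodMk_nhds hw')) (hw.prodMk_nhds (hb.prodMk_nhds ?_))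
  simp

/-- The point to which an ultrafilter that goes to infinity carries almost all points of `T` is a
limit point of `G`. -/
lemma IsRelHypAction.mem_limitSet (h : IsRelHypAction G T)
    {𝒰 : Ultrafilter G} (h𝒰 : (𝒰 : Filter G) ≤ cofinite) {a : T}
    (ha : {y : T | ¬ Tendsto (fun g : G => g • y) 𝒰 (𝓝 a)}.Subsingleton) :
    a ∈ limitSet G T := by
  -- The repeller is the attractor of the inverted ultrafilter.
  obtain ⟨r, hr⟩ := h.exists_subsingleton_not_tendsto (𝒰 := 𝒰.map (·⁻¹))
    ((Filter.map_mono h𝒰).trans inv_injective.tendsto_cofinite)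
  refine ⟨r, fun U hU V hV => ?_⟩
  have hev := h.eventually_smul_mem h𝒰 ha (r := r) (by
    simpa only [Ultrafilter.coe_map, tendsto_map'_iff, Function.comp_def] using hr) hU hV
  intro hfin
  obtain ⟨g, h1, h2⟩ := (hev.and (h𝒰 hfin.compl_mem_cofinite)).exists
  exact h2 ⟨mem_univ g, h1⟩

end Convergence

/-! ### Majority limits -/

section Majority

variable {G T : Type*} [Group G] [TopologicalSpace T] [MulAction G T]

/-- Along the filter `F`, at least two of the three points `g • x j` tend to `a`, where the index
of the exceptional point is allowed to vary with `g` and with the neighborhood of `a`. -/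
def MajorityTendsto (x : Fin 3 → T) (F : Filter G) (a : T) : Prop :=
  ∀ V ∈ 𝓝 a, ∀ᶠ g in F, ∃ i, ∀ j ≠ i, g • x j ∈ V

lemma Fin.exists_ne_of_three (i j : Fin 3) : ∃ k, k ≠ i ∧ k ≠ j := by
  revert i j; decide

lemma MajorityTendsto.mono {x : Fin 3 → T} {F F' : Filter G} {a : T}
    (h : MajorityTendsto x F a) (hF : F' ≤ F) : MajorityTendsto x F' a :=
  fun V hV => hF (h V hV)

/-- Two majorities among three indices have an index in common. -/
lemma MajorityTendsto.mem_of_isClosed {x : Fin 3 → T} {F : Filter G} [F.NeBot] {a : T}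
    (h : MajorityTendsto x F a) {C : Set T} (hC : IsClosed C)
    (hF : ∀ᶠ g in F, ∃ i, ∀ j ≠ i, g • x j ∈ C) : a ∈ C := by
  by_contra ha
  obtain ⟨g, ⟨i, hi⟩, ⟨i', hi'⟩⟩ := (hF.and (h _ (hC.isOpen_compl.mem_nhds ha))).exists
  obtain ⟨k, hk, hk'⟩ := Fin.exists_ne_of_three i i'
  exact hi' k hk' (hi k hk)

lemma MajorityTendsto.unique [T2Space T] {x : Fin 3 → T} {F : Filter G} [F.NeBot] {a b : T}
    (ha : MajorityTendsto x F a) (hb : MajorityTendsto x F b) : a = b := by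
  by_contra hab
  obtain ⟨U, V, hU, hV, haU, hbV, hUV⟩ := t2_separation hab
  refine hb.mem_of_isClosed hV.isClosed_compl ?_ hbV
  filter_upwards [ha U (hU.mem_nhds haU)] with g ⟨i, hi⟩
  exact ⟨i, fun j hj => hUV.subset_compl_right (hi j hj)⟩

lemma MajorityTendsto.smul [T2Space T] {x : Fin 3 → T} {F : Filter G} {a : T}
    (ha : MajorityTendsto x F a) {h : G} (hc : Continuous fun y : T => h • y) :
    MajorityTendsto x (F.map (h * ·)) (h • a) := by
  intro V hV
  rw [eventually_map]
  filter_upwards [ha _ (hc.continuousAt.preimage_mem_nhds hV)] with g ⟨i, hi⟩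
  exact ⟨i, fun j hj => by simpa [mul_smul] using hi j hj⟩

lemma majorityTendsto_of_ultrafilter {x : Fin 3 → T} {F : Filter G} {a : T}
    (h : ∀ 𝒰 : Ultrafilter G, (𝒰 : Filter G) ≤ F → MajorityTendsto x (𝒰 : Filter G) a) :
    MajorityTendsto x F a := fun V hV =>
  mem_iff_ultrafilter.2 fun 𝒰 h𝒰 => h 𝒰 h𝒰 V hV

/-- The points `h • x j` are distinct, so at most one of them is the exceptional point. -/
lemma MajorityTendsto.of_subsingleton {x : Fin 3 → T} (hx : Function.Injective x)
    {F : Filter G} {a : T} (ha : {y : T | ¬ Tendsto (fun g : G => g • y) F (𝓝 a)}.Subsingleton)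
    (h : G) : MajorityTendsto x (F.map (· * h)) a := by
  obtain ⟨i, hi⟩ : ∃ i, ∀ j ≠ i, Tendsto (fun g : G => g • h • x j) F (𝓝 a) := by
    by_cases hall : ∃ i, ¬ Tendsto (fun g : G => g • h • x i) F (𝓝 a)
    · obtain ⟨i, hi⟩ := hall
      refine ⟨i, fun j hj => ?_⟩
      by_contra hj'
      exact hj (hx (MulAction.injective h (ha hj' hi)))
    · push Not at hall
      exact ⟨0, fun j _ => hall j⟩
  intro V hV
  rw [eventually_map]
  have : ∀ᶠ g in F, ∀ j, j ≠ i → g • h • x j ∈ V :=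
    eventually_all.2 fun j => by
      by_cases hj : j = i
      · simp [hj]
      · filter_upwards [(hi j hj).eventually_mem hV] with g hg _ using hg
  filter_upwards [this] with g hg
  exact ⟨i, fun j hj => by simpa [mul_smul] using hg j hj⟩

/-- An ultrafilter going to infinity has a majority limit, which is a limit point of `G` and does
not change under right multiplication. -/
lemma IsRelHypAction.exists_majorityTendsto (h : IsRelHypAction G T) {x : Fin 3 → T}
    (hx : Function.Injective x) {𝒰 : Ultrafilter G} (h𝒰 : (𝒰 : Filter G) ≤ cofinite) :
    ∃ a ∈ limitSet G T, MajorityTendsto x (𝒰 : Filter G) a ∧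
      ∀ s : G, MajorityTendsto x (Filter.map (· * s) 𝒰) a := by
  obtain ⟨a, ha⟩ := h.exists_subsingleton_not_tendsto h𝒰
  refine ⟨a, h.mem_limitSet h𝒰 ha, ?_, .of_subsingleton hx ha⟩
  simpa using MajorityTendsto.of_subsingleton hx ha 1

/-- Two group elements are close if they are equal, or both are different from `1` and two of the
points `g • x i` are close to two of the points `h • x j`, as measured by `W`. -/
def MajorityClose (x : Fin 3 → T) (W : Set (T × T)) (g h : G) : Prop :=
  g = h ∨ g ≠ 1 ∧ h ≠ 1 ∧ ∃ i j, ∀ i' ≠ i, ∀ j' ≠ j, (g • x i', h • x j') ∈ W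

omit [TopologicalSpace T] in
lemma MajorityClose.refl (x : Fin 3 → T) (W : Set (T × T)) (g : G) : MajorityClose x W g g :=
  Or.inl rfl

omit [TopologicalSpace T] in
lemma MajorityClose.symm {x : Fin 3 → T} {W : Set (T × T)}
    (hW : ∀ p ∈ W, p.swap ∈ W) {g h : G} (hgh : MajorityClose x W g h) :
    MajorityClose x W h g := by
  rcases hgh with rfl | ⟨hg, hh, i, j, hij⟩
  · exact .refl _ _ _
  · exact Or.inr ⟨hh, hg, j, i, fun j' hj' i' hi' => hW _ (hij i' hi' j' hj')⟩

omit [TopologicalSpace T] in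
lemma MajorityClose.eq_of_one {x : Fin 3 → T} {W : Set (T × T)} {h : G}
    (hh : MajorityClose x W 1 h) : h = 1 := by
  rcases hh with rfl | ⟨h1, -⟩
  · rfl
  · exact absurd rfl h1

lemma MajorityTendsto.eventually_prod {x : Fin 3 → T} {F F' : Filter G} {a b : T}
    (ha : MajorityTendsto x F a) (hb : MajorityTendsto x F' b) {N : Set (T × T)}
    (hN : N ∈ 𝓝 (a, b)) :
    ∀ᶠ p in F ×ˢ F', ∃ i j, ∀ i' ≠ i, ∀ j' ≠ j, (p.1 • x i', p.2 • x j') ∈ N := by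
  obtain ⟨U, hU, V, hV, hUV⟩ := mem_nhds_prod_iff.1 hN
  filter_upwards [(ha U hU).prod_mk (hb V hV)] with p ⟨⟨i, hi⟩, ⟨j, hj⟩⟩
  exact ⟨i, j, fun i' hi' j' hj' => hUV ⟨hi i' hi', hj j' hj'⟩⟩

lemma MajorityTendsto.eventually_majorityClose {x : Fin 3 → T} {F F' : Filter G} {a : T}
    (ha : MajorityTendsto x F a) (hb : MajorityTendsto x F' a) (hF : F ≤ cofinite)
    (hF' : F' ≤ cofinite) {W : Set (T × T)} (hW : W ∈ 𝓝 (a, a)) :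
    ∀ᶠ p in F ×ˢ F', MajorityClose x W p.1 p.2 := by
  filter_upwards [ha.eventually_prod hb hW,
    Eventually.prod_mk (hF (finite_singleton (1 : G)).compl_mem_cofinite)
      (hF' (finite_singleton (1 : G)).compl_mem_cofinite)] with p hp ⟨h1, h2⟩
  exact Or.inr ⟨h1, h2, hp⟩

/-- Overlapping majorities would give a pair in both `N` and `W`; for equal elements this pair lies
on the diagonal. -/
lemma MajorityTendsto.eventually_not_majorityClose {x : Fin 3 → T} {F F' : Filter G} {a b : T}
    (ha : MajorityTendsto x F a) (hb : MajorityTendsto x F' b) {W N : Set (T × T)}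
    (hN : N ∈ 𝓝 (a, b)) (hNW : Disjoint N W) (hW : ∀ y, (y, y) ∈ W) :
    ∀ᶠ p in F ×ˢ F', ¬ MajorityClose x W p.1 p.2 := by
  filter_upwards [ha.eventually_prod hb hN] with p ⟨i, j, hij⟩ hc
  rcases hc with hp | ⟨-, -, k, l, hkl⟩
  · obtain ⟨m, hmi, hmj⟩ := Fin.exists_ne_of_three i j
    refine hNW.ne_of_mem (hij m hmi m hmj) (hW (p.1 • x m)) ?_
    rw [hp]
  · obtain ⟨m, hmi, hmk⟩ := Fin.exists_ne_of_three i k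
    obtain ⟨n, hnj, hnl⟩ := Fin.exists_ne_of_three j l
    exact hNW.ne_of_mem (hij m hmi n hnj) (hkl m hmk n hnl) rfl

end Majority

/-! ### Expansivity and dividers -/

section Divider

variable {G T : Type*} [Group G] [TopologicalSpace T] [MulAction G T]

/-- A symmetric neighborhood of the diagonal of `T` such that every pair of distinct points can be
moved by `G` away from it. -/
structure IsExpansive (G : Type*) {T : Type*} [Group G] [TopologicalSpace T] [MulAction G T]
    (W : Set (T × T)) : Prop where
  mem_nhds : ∀ y, W ∈ 𝓝 (y, y)
  swap_mem : ∀ p ∈ W, p.swap ∈ W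
  exists_disjoint : ∀ a b : T, a ≠ b → ∃ g : G, ∃ N ∈ 𝓝 (g • a, g • b), Disjoint N W

/-- The compact set of representatives of pairs is disjoint from the diagonal, so the two have
disjoint open neighborhoods. -/
lemma IsRelHypAction.exists_isExpansive (h : IsRelHypAction G T) :
    ∃ W : Set (T × T), IsExpansive G W := by
  have := h.compactSpace
  have := h.t2Space
  obtain ⟨K, hK, hKd, hcov⟩ := h.cocompact
  obtain ⟨A, B, hA, hB, hdA, hKB, hAB⟩ := SeparatedNhds.of_isCompact_isCompact
    (isClosed_diagonal (X := T)).isCompact hK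
    (disjoint_left.2 fun p hp hpK => hKd p hpK hp)
  refine ⟨A ∩ Prod.swap ⁻¹' A, ⟨fun y => ?_, fun p hp => ⟨hp.2, by simpa using hp.1⟩,
    fun a b hab => ?_⟩⟩
  · exact (hA.inter (hA.preimage continuous_swap)).mem_nhds
      ⟨hdA (mem_diagonal y), hdA (mem_diagonal y)⟩
  · obtain ⟨g, hg⟩ := hcov (a, b) hab
    exact ⟨g, B, hB.mem_nhds (hKB hg), (hAB.mono_left inter_subset_left).symm⟩

lemma IsExpansive.mk_mem {W : Set (T × T)} (hW : IsExpansive G W) (y : T) : (y, y) ∈ W :=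
  mem_of_mem_nhds (hW.mem_nhds y)

/-- Convergence of a filter on `G` in the attractor sum of `G` and `T`. -/
def AttractorSumTendsto (x : Fin 3 → T) (F : Filter G) : G ⊕ T → Prop
  | .inl g => ∀ᶠ g' in F, g' = g
  | .inr a => F ≤ cofinite ∧ MajorityTendsto x F a

/-- This is the compactness of the attractor sum. -/
lemma IsRelHypAction.exists_attractorSumTendsto (h : IsRelHypAction G T) {x : Fin 3 → T}
    (hx : Function.Injective x) (𝒰 : Ultrafilter G) :
    ∃ c : G ⊕ T, AttractorSumTendsto x (𝒰 : Filter G) c := by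
  rcases 𝒰.le_cofinite_or_eq_pure with h𝒰 | ⟨g, rfl⟩
  · obtain ⟨a, -, ha, -⟩ := h.exists_majorityTendsto hx h𝒰
    exact ⟨.inr a, h𝒰, ha⟩
  · exact ⟨.inl g, by simp [AttractorSumTendsto]⟩

lemma AttractorSumTendsto.eventually_majorityClose {x : Fin 3 → T} {W : Set (T × T)}
    (hW : IsExpansive G W) {F F' : Filter G} {c : G ⊕ T} (h : AttractorSumTendsto x F c)
    (h' : AttractorSumTendsto x F' c) : ∀ᶠ p in F ×ˢ F', MajorityClose x W p.1 p.2 := by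
  rcases c with g | a
  · filter_upwards [Eventually.prod_mk h h'] with p ⟨h1, h2⟩
    exact Or.inl (h1.trans h2.symm)
  · exact h.2.eventually_majorityClose h'.2 h.1 h'.1 (hW.mem_nhds a)

/-- Translation by `g⁻¹` brings `g` to `1`, which is close only to itself. This is the purpose of
excluding `1` in `MajorityClose`. -/
lemma AttractorSumTendsto.eq_of_inl {x : Fin 3 → T} {W : Set (T × T)}
    {ι : Type*} {l : Filter ι} [l.NeBot] {u u' : ι → G} {g : G} {c : G ⊕ T}
    (h : AttractorSumTendsto x (map u l) (.inl g)) (h' : AttractorSumTendsto x (map u' l) c)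
    (hu : ∀ f : G, ∀ᶠ i in l, MajorityClose x W (f * u i) (f * u' i)) : c = .inl g := by
  have hg : ∀ᶠ i in l, u' i = g := by
    filter_upwards [hu g⁻¹, eventually_map.1 h] with i hi hi'
    rw [hi', inv_mul_cancel] at hi
    exact (inv_mul_eq_one.1 hi.eq_of_one).symm
  rcases c with g' | a
  · obtain ⟨i, hi, hi'⟩ := (hg.and (eventually_map.1 h')).exists
    rw [← hi, ← hi']
  · obtain ⟨i, hi, hi'⟩ :=
      (hg.and (eventually_map.1 (h'.1 (finite_singleton g).compl_mem_cofinite))).exists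
    exact absurd hi hi'

/-- The translates of the relation separate the points of the attractor sum: group elements because
`1` is isolated, points of `T` by expansivity. -/
lemma AttractorSumTendsto.eq (hc : ∀ g : G, Continuous fun y : T => g • y) [T2Space T]
    {x : Fin 3 → T} {W : Set (T × T)} (hW : IsExpansive G W)
    {ι : Type*} {l : Filter ι} [l.NeBot] {u u' : ι → G} {c c' : G ⊕ T}
    (h : AttractorSumTendsto x (map u l) c) (h' : AttractorSumTendsto x (map u' l) c')
    (hu : ∀ f : G, ∀ᶠ i in l, MajorityClose x W (f * u i) (f * u' i)) : c = c' := by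
  rcases c with g | a
  · exact (h.eq_of_inl h' hu).symm
  rcases c' with g | b
  · exact h'.eq_of_inl h fun f => (hu f).mono fun i hi => hi.symm hW.swap_mem
  by_contra hne
  obtain ⟨f, N, hN, hNW⟩ := hW.exists_disjoint a b fun e => hne (congrArg _ e)
  have hev := (h.2.smul (hc f)).eventually_not_majorityClose (h'.2.smul (hc f)) hN hNW hW.mk_mem
  have ht : Tendsto (fun i => (f * u i, f * u' i)) l
      (map (f * ·) (map u l) ×ˢ map (f * ·) (map u' l)) :=
    (tendsto_map.comp tendsto_map).prodMk (tendsto_map.comp tendsto_map)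
  obtain ⟨i, hi, hi'⟩ := ((ht.eventually hev).and (hu f)).exists
  exact hi hi'

/-- A finite set `F` such that the relation `MajorityClose`, imposed after translation by all
elements of `F`, can be composed three times. -/
lemma IsRelHypAction.exists_divider (h : IsRelHypAction G T) {x : Fin 3 → T}
    (hx : Function.Injective x) {W : Set (T × T)} (hW : IsExpansive G W) :
    ∃ F : Finset G, ∀ g₁ g₂ g₃ g₄ : G,
      (∀ f ∈ F, MajorityClose x W (f * g₁) (f * g₂) ∧ MajorityClose x W (f * g₂) (f * g₃) ∧
        MajorityClose x W (f * g₃) (f * g₄)) → MajorityClose x W g₁ g₄ := by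
  have := h.t2Space
  by_contra! hcon
  choose u₁ u₂ u₃ u₄ hu hnot using hcon
  -- Along `𝒱` every `f` eventually lies in the finite set, so consecutive sequences are close after
  -- every translation and all four have the same limit.
  set 𝒱 : Ultrafilter (Finset G) := .of atTop
  have hev : ∀ f : G, ∀ᶠ F in (𝒱 : Filter (Finset G)), f ∈ F := fun f =>
    Ultrafilter.of_le _ ((eventually_ge_atTop {f}).mono fun F hF => by simpa using hF)
  obtain ⟨c₁, h₁⟩ := h.exists_attractorSumTendsto hx (𝒱.map u₁)
  obtain ⟨c₂, h₂⟩ := h.exists_attractorSumTendsto hx (𝒱.map u₂)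
  obtain ⟨c₃, h₃⟩ := h.exists_attractorSumTendsto hx (𝒱.map u₃)
  obtain ⟨c₄, h₄⟩ := h.exists_attractorSumTendsto hx (𝒱.map u₄)
  obtain rfl := AttractorSumTendsto.eq h.continuous_smul hW h₁ h₂
    fun f => (hev f).mono fun F hF => (hu F f hF).1
  obtain rfl := AttractorSumTendsto.eq h.continuous_smul hW h₂ h₃
    fun f => (hev f).mono fun F hF => (hu F f hF).2.1
  obtain rfl := AttractorSumTendsto.eq h.continuous_smul hW h₃ h₄
    fun f => (hev f).mono fun F hF => (hu F f hF).2.2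
  have ht : Tendsto (fun F => (u₁ F, u₄ F)) (𝒱 : Filter (Finset G))
    (((𝒱.map u₁ : Ultrafilter G) : Filter G) ×ˢ ((𝒱.map u₄ : Ultrafilter G) : Filter G)) :=
    Tendsto.prodMk tendsto_map tendsto_map
  obtain ⟨F, hF⟩ := (ht.eventually (h₁.eventually_majorityClose hW h₄)).exists
  exact hnot F hF

/-- For all but finitely many edges of the Cayley graph with a given label, the end points are
close. -/
lemma IsRelHypAction.finite_not_majorityClose_mul (h : IsRelHypAction G T) {x : Fin 3 → T}
    (hx : Function.Injective x) {W : Set (T × T)} (hW : IsExpansive G W) (s : G) :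
    {g : G | ¬ MajorityClose x W g (g * s)}.Finite := by
  by_contra hinf
  have := Set.Infinite.cofinite_inf_principal_neBot hinf
  obtain ⟨𝒰, h𝒰⟩ := Ultrafilter.exists_le (cofinite ⊓ 𝓟 {g : G | ¬ MajorityClose x W g (g * s)})
  have hcof : (𝒰 : Filter G) ≤ cofinite := h𝒰.trans inf_le_left
  obtain ⟨a, -, ha, has⟩ := h.exists_majorityTendsto hx hcof
  have hev := ha.eventually_majorityClose (has s) hcof
    ((mul_left_injective s).tendsto_cofinite.mono_left hcof) (hW.mem_nhds a)
  obtain ⟨g, hg, hg'⟩ := (((tendsto_id.prodMk tendsto_map).eventually hev).and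
    (h𝒰 (mem_inf_of_right (mem_principal_self _)))).exists
  exact hg' hg

end Divider

/-! ### Comparison with the Floyd metric -/

namespace FiniteGeneratingSet

variable {G : Type*} [Group G] (S : FiniteGeneratingSet G)

/-- The supremum of `l ^ |k|` over all `k` that move the pair `(g, h)` out of the relation `R`. -/
noncomputable def escapeSize (R : G → G → Prop) (l : ℝ≥0) (g h : G) : ℝ≥0 :=
  ⨆ k : {k : G // ¬ R (k * g) (k * h)}, l ^ S.wordLength k

variable {S} {R : G → G → Prop} {l : ℝ≥0}

lemma pow_le_escapeSize (hl : l ≤ 1) {g h k : G} (hk : ¬ R (k * g) (k * h)) :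
    l ^ S.wordLength k ≤ S.escapeSize R l g h :=
  le_ciSup (f := fun k : {k : G // ¬ R (k * g) (k * h)} => l ^ S.wordLength (k : G))
    ⟨1, by rintro _ ⟨k, rfl⟩; exact pow_le_one₀ zero_le hl⟩ ⟨k, hk⟩

/-- No `k` need exist: the empty supremum in `ℝ≥0` is `0`. -/
lemma escapeSize_le {g h : G} {c : ℝ≥0}
    (hc : ∀ k, ¬ R (k * g) (k * h) → l ^ S.wordLength k ≤ c) : S.escapeSize R l g h ≤ c :=
  ciSup_le' fun k => hc k k.2

lemma escapeSize_self (hR : ∀ g, R g g) (g : G) : S.escapeSize R l g g = 0 :=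
  le_antisymm (escapeSize_le fun _ hk => absurd (hR _) hk) zero_le

lemma escapeSize_comm (hR : ∀ g h, R g h → R h g) (g h : G) :
    S.escapeSize R l g h = S.escapeSize R l h g := by
  have : (fun k => ¬ R (k * g) (k * h)) = fun k => ¬ R (k * h) (k * g) :=
    funext fun k => propext (not_congr ⟨hR _ _, hR _ _⟩)
  rw [escapeSize, escapeSize, this]

/-- The triangle inequality of Frink's metrization lemma. -/
lemma escapeSize_le_two_mul_max (hl : l ≤ 1) {F : Finset G}
    (hF : ∀ g₁ g₂ g₃ g₄ : G,
      (∀ f ∈ F, R (f * g₁) (f * g₂) ∧ R (f * g₂) (f * g₃) ∧ R (f * g₃) (f * g₄)) → R g₁ g₄)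
    (hlF : ∀ f ∈ F, 1 ≤ 2 * l ^ S.wordLength f⁻¹) (g₁ g₂ g₃ g₄ : G) :
    S.escapeSize R l g₁ g₄ ≤ 2 * max (S.escapeSize R l g₁ g₂)
      (max (S.escapeSize R l g₂ g₃) (S.escapeSize R l g₃ g₄)) := by
  refine escapeSize_le fun k hk => ?_
  -- If `k` separates `g₁` from `g₄`, then some `f * k` separates a consecutive pair. Its length
  -- exceeds that of `k` by at most `|f⁻¹|`, a loss that the factor `2` absorbs.
  obtain ⟨f, hf, hfk⟩ : ∃ f ∈ F, ¬ (R (f * k * g₁) (f * k * g₂) ∧ R (f * k * g₂) (f * k * g₃) ∧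
      R (f * k * g₃) (f * k * g₄)) := by
    by_contra! hcon
    refine hk (hF _ (k * g₂) (k * g₃) _ fun f hf => ?_)
    simpa only [mul_assoc] using hcon f hf
  have hpow : l ^ S.wordLength k ≤ 2 * l ^ S.wordLength (f * k) := by
    have h1 := S.wordLength_le f⁻¹ (f * k)
    rw [inv_mul_cancel_left] at h1
    calc l ^ S.wordLength k ≤ (2 * l ^ S.wordLength f⁻¹) * l ^ S.wordLength k :=
          le_mul_of_one_le_left zero_le (hlF f hf)
      _ = 2 * l ^ (S.wordLength f⁻¹ + S.wordLength k) := by rw [pow_add, mul_assoc]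
      _ ≤ 2 * l ^ S.wordLength (f * k) := by
          exact mul_le_mul_right (pow_le_pow_of_le_one zero_le hl h1) 2
  refine hpow.trans ?_
  gcongr
  by_cases h1 : R (f * k * g₁) (f * k * g₂)
  · by_cases h2 : R (f * k * g₂) (f * k * g₃)
    · exact (pow_le_escapeSize hl fun h3 => hfk ⟨h1, h2, h3⟩).trans
        ((le_max_right _ _).trans (le_max_right _ _))
    · exact (pow_le_escapeSize hl h2).trans ((le_max_left _ _).trans (le_max_right _ _))
  · exact (pow_le_escapeSize hl h1).trans (le_max_left _ _)

/-- If `k` moves the edge to one that is not close, then `|k * g| ≤ C`, whence `|g| ≤ |k| + C`. -/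
lemma pow_mul_escapeSize_mul_le (hl0 : 0 < l) (hl : l ≤ 1) {g s : G} {C : ℕ}
    (hC : ∀ g, ¬ R g (g * s) → S.wordLength g ≤ C) :
    l ^ C * S.escapeSize R l g (g * s) ≤ l ^ S.wordLength g := by
  rw [← le_div_iff₀' (pow_pos hl0 _)]
  refine escapeSize_le fun k hk => ?_
  rw [le_div_iff₀' (pow_pos hl0 _), ← pow_add]
  refine pow_le_pow_of_le_one zero_le hl ?_
  have h1 := S.wordLength_le k g
  have h2 := hC (k * g) (by rwa [mul_assoc])
  omega

lemma pow_mul_escapeSize_le_of_adj (hl0 : 0 < l) (hl : l ≤ 1) (hR : ∀ g h, R g h → R h g) {C : ℕ}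
    (hC : ∀ s ∈ S.carrier, ∀ g, ¬ R g (g * s) → S.wordLength g ≤ C) {g h : G}
    (hgh : S.cayleyGraph.Adj g h) :
    l ^ C * S.escapeSize R l g h ≤ l ^ min (S.wordLength g) (S.wordLength h) := by
  rw [SimpleGraph.mulCayley_adj'] at hgh
  obtain ⟨-, s, hs, rfl | rfl⟩ := hgh
  · exact (pow_mul_escapeSize_mul_le hl0 hl (hC s hs)).trans
      (pow_le_pow_of_le_one zero_le hl (min_le_left _ _))
  · rw [escapeSize_comm hR]
    exact (pow_mul_escapeSize_mul_le hl0 hl (hC s hs)).trans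
      (pow_le_pow_of_le_one zero_le hl (min_le_right _ _))

lemma exists_one_le_two_mul_pow (N : ℕ) : ∃ lam : Set.Ioo (0 : ℝ) 1, 1 ≤ 2 * (lam : ℝ) ^ N := by
  have hN : (0 : ℝ) < 2 * (N + 1) := by positivity
  have h1 : 1 / (2 * ((N : ℝ) + 1)) ≤ 1 / 2 := by
    apply one_div_le_one_div_of_le <;> [norm_num; linarith [(Nat.cast_nonneg N : (0 : ℝ) ≤ N)]]
  have h0 : 0 < 1 / (2 * ((N : ℝ) + 1)) := by positivity
  -- By Bernoulli, the `N`-th power of this number is at least `1 - N / (2 * (N + 1)) ≥ 1 / 2`.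
  refine ⟨⟨1 + -(1 / (2 * ((N : ℝ) + 1))), by linarith, by linarith⟩, ?_⟩
  have hb := one_add_mul_le_pow (a := -(1 / (2 * ((N : ℝ) + 1)))) (by linarith) N
  have h2 : (N : ℝ) * (1 / (2 * ((N : ℝ) + 1))) ≤ 1 / 2 := by
    rw [mul_one_div, div_le_div_iff₀ hN two_pos]
    linarith
  change 1 ≤ 2 * (1 + -(1 / (2 * ((N : ℝ) + 1)))) ^ N
  linarith

lemma ofReal_dist_le_floydWalkLength [PseudoMetricSpace G] (lam : Set.Ioo (0 : ℝ) 1) {c : ℝ}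
    (hc : 0 ≤ c) (h : ∀ u v, S.cayleyGraph.Adj u v →
      c * dist u v ≤ (lam : ℝ) ^ min (S.wordLength u) (S.wordLength v)) {u v : G}
    (p : S.cayleyGraph.Walk u v) : ENNReal.ofReal (c * dist u v) ≤ S.floydWalkLength lam p := by
  induction p with
  | nil => simp
  | @cons u v w huv p ih =>
    calc ENNReal.ofReal (c * dist u w)
        ≤ ENNReal.ofReal (c * dist u v + c * dist v w) := by
          rw [← mul_add]
          exact ENNReal.ofReal_le_ofReal (mul_le_mul_of_nonneg_left (dist_triangle _ _ _) hc)
      _ ≤ ENNReal.ofReal (c * dist u v) + ENNReal.ofReal (c * dist v w) := ENNReal.ofReal_add_le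
      _ ≤ S.floydEdgeLength lam u v + S.floydWalkLength lam p :=
          add_le_add (ENNReal.ofReal_le_ofReal (h u v huv)) ih
      _ = S.floydWalkLength lam (.cons huv p) := by simp [floydWalkLength]

/-- The Floyd metric controls every relation on `G` that can be composed after finitely many
translations and contains all but finitely many edges. -/
theorem exists_floydEDist_lt (S : FiniteGeneratingSet G) (hrefl : ∀ g, R g g)
    (hsymm : ∀ g h, R g h → R h g) {F : Finset G}
    (hF : ∀ g₁ g₂ g₃ g₄ : G,
      (∀ f ∈ F, R (f * g₁) (f * g₂) ∧ R (f * g₂) (f * g₃) ∧ R (f * g₃) (f * g₄)) → R g₁ g₄)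
    (hfin : ∀ s, {g | ¬ R g (g * s)}.Finite) :
    ∃ lam : Set.Ioo (0 : ℝ) 1, ∀ k : G, ∃ ε > 0, ∀ g h : G,
      S.floydEDist lam g h < ε → R (k * g) (k * h) := by
  obtain ⟨lam, hlam⟩ := exists_one_le_two_mul_pow (F.sup fun f => S.wordLength f⁻¹)
  set l : ℝ≥0 := ⟨lam, lam.2.1.le⟩
  have hl0 : 0 < l := lam.2.1
  have hl1 : l ≤ 1 := lam.2.2.le
  have hlF : ∀ f ∈ F, 1 ≤ 2 * l ^ S.wordLength f⁻¹ := fun f hf =>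
    le_trans (show 1 ≤ 2 * l ^ F.sup fun f => S.wordLength f⁻¹ from hlam)
      (mul_le_mul_right (pow_le_pow_of_le_one zero_le hl1
        (Finset.le_sup (f := fun f => S.wordLength f⁻¹) hf)) 2)
  obtain ⟨C, hC⟩ : ∃ C, ∀ s ∈ S.carrier, ∀ g, ¬ R g (g * s) → S.wordLength g ≤ C := by
    refine ⟨S.carrier.sup fun s => (hfin s).toFinset.sup S.wordLength, fun s hs g hg => ?_⟩
    exact (Finset.le_sup (f := S.wordLength) ((hfin s).mem_toFinset.2 hg)).trans
      (Finset.le_sup (f := fun s => (hfin s).toFinset.sup S.wordLength) hs)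
  -- Frink's chain construction: the resulting distance lies between half of `escapeSize` and
  -- `escapeSize`.
  let _ : PseudoMetricSpace G := PseudoMetricSpace.ofPreNNDist (S.escapeSize R l)
    (escapeSize_self hrefl) (escapeSize_comm hsymm)
  have hle : ∀ u v : G, dist u v ≤ S.escapeSize R l u v :=
    PseudoMetricSpace.dist_ofPreNNDist_le _ _ _
  have hge : ∀ u v : G, (S.escapeSize R l u v : ℝ) ≤ 2 * dist u v :=
    PseudoMetricSpace.le_two_mul_dist_ofPreNNDist _ _ _ (escapeSize_le_two_mul_max hl1 hF hlF)
  have hadj : ∀ u v, S.cayleyGraph.Adj u v →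
      (lam : ℝ) ^ C * dist u v ≤ (lam : ℝ) ^ min (S.wordLength u) (S.wordLength v) :=
    fun u v huv => (mul_le_mul_of_nonneg_left (hle u v) (pow_nonneg lam.2.1.le _)).trans
      (NNReal.coe_le_coe.2 (pow_mul_escapeSize_le_of_adj hl0 hl1 hsymm hC huv))
  have hpos := lam.2.1
  -- If `k` separates `g` from `h`, then `lam ^ |k| ≤ 2 * dist g h`, while every path from `g` to
  -- `h` has Floyd length at least `lam ^ C * dist g h`.
  refine ⟨lam, fun k => ⟨ENNReal.ofReal ((lam : ℝ) ^ C * ((lam : ℝ) ^ S.wordLength k / 2)),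
    ENNReal.ofReal_pos.2 (by positivity), fun g h hgh => ?_⟩⟩
  by_contra hk
  refine hgh.not_ge (le_iInf fun p => le_trans (ENNReal.ofReal_le_ofReal ?_)
    (ofReal_dist_le_floydWalkLength lam (by positivity) hadj p))
  have h1 : (lam : ℝ) ^ S.wordLength k ≤ S.escapeSize R l g h :=
    NNReal.coe_le_coe.2 (pow_le_escapeSize hl1 hk)
  exact mul_le_mul_of_nonneg_left (by linarith [hge g h]) (by positivity)

end FiniteGeneratingSet

/-! ### The Floyd map -/

section FloydMap

variable {G T : Type*} [Group G] [TopologicalSpace T] [MulAction G T]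

/-- The inclusion of `G` in its Floyd completion. -/
noncomputable def toFloydCompletion (S : FiniteGeneratingSet G) (lam : Set.Ioo (0 : ℝ) 1) (g : G) :
    UniformSpace.Completion (FloydGroup S lam) :=
  ((show FloydGroup S lam from g) : UniformSpace.Completion (FloydGroup S lam))

variable {S : FiniteGeneratingSet G} {lam : Set.Ioo (0 : ℝ) 1}

lemma toFloydCompletion_mul (g h : G) :
    toFloydCompletion S lam (g * h) = g • toFloydCompletion S lam h :=
  UniformSpace.Completion.coe_smul (X := FloydGroup S lam) g h

/-- The trace on `G` of the neighborhoods of a point of the Floyd completion. -/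
noncomputable def floydFilter (x : UniformSpace.Completion (FloydGroup S lam)) : Filter G :=
  comap (toFloydCompletion S lam) (𝓝 x)

instance (x : UniformSpace.Completion (FloydGroup S lam)) : (floydFilter x).NeBot :=
  UniformSpace.Completion.isDenseInducing_coe.comap_nhds_neBot x

/-- Points are closed in the completion, so a boundary point has a neighborhood missing any given
`g`. -/
lemma floydFilter_le_cofinite (x : FloydBoundary S lam) :
    floydFilter (x : UniformSpace.Completion (FloydGroup S lam)) ≤ cofinite := by
  refine le_cofinite_iff_eventually_ne.2 fun g => ?_
  have hne : (x : UniformSpace.Completion (FloydGroup S lam)) ≠ toFloydCompletion S lam g :=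
    fun h => x.2 ⟨g, h.symm⟩
  filter_upwards [preimage_mem_comap (m := toFloydCompletion S lam)
    (isOpen_ne.mem_nhds hne)] with h hh
  rintro rfl
  exact hh rfl

lemma eventually_floydEDist_lt (x : UniformSpace.Completion (FloydGroup S lam)) {ε : ℝ≥0∞}
    (hε : 0 < ε) :
    ∀ᶠ p in floydFilter x ×ˢ floydFilter x, S.floydEDist lam p.1 p.2 < ε := by
  have hc : Cauchy (comap ((↑) : FloydGroup S lam → UniformSpace.Completion (FloydGroup S lam))
      (𝓝 x)) := cauchy_nhds.comap'
    (UniformSpace.Completion.isUniformInducing_coe _).comap_uniformity.le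
    (UniformSpace.Completion.isDenseInducing_coe.comap_nhds_neBot x)
  exact hc.2 (edist_mem_uniformity (α := FloydGroup S lam) hε)

lemma map_mul_floydFilter_le (g : G) (x : UniformSpace.Completion (FloydGroup S lam)) :
    map (g * ·) (floydFilter x) ≤ floydFilter (g • x) := by
  refine map_le_iff_le_comap.2 ?_
  rw [floydFilter, floydFilter, comap_comap]
  have : toFloydCompletion S lam ∘ (g * ·) = (g • ·) ∘ toFloydCompletion S lam :=
    funext fun h => toFloydCompletion_mul g h
  rw [this, ← comap_comap]
  exact comap_mono ((continuous_const_smul g).tendsto x).le_comap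

/-- If the Floyd metric controls `MajorityClose`, then the elements of `G` that converge to a
given point of the Floyd boundary have a majority limit. -/
lemma IsRelHypAction.exists_majorityTendsto_floydFilter (h : IsRelHypAction G T) {x : Fin 3 → T}
    (hx : Function.Injective x) {W : Set (T × T)} (hW : IsExpansive G W)
    (hlam : ∀ k : G, ∃ ε > 0, ∀ g g' : G,
      S.floydEDist lam g g' < ε → MajorityClose x W (k * g) (k * g')) (z : FloydBoundary S lam) :
    ∃ a ∈ limitSet G T,
      MajorityTendsto x (floydFilter (z : UniformSpace.Completion (FloydGroup S lam))) a := by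
  have := h.t2Space
  set F := floydFilter (z : UniformSpace.Completion (FloydGroup S lam))
  have hF : F ≤ cofinite := floydFilter_le_cofinite z
  obtain ⟨a, ha, hlim, -⟩ := h.exists_majorityTendsto hx ((Ultrafilter.of_le F).trans hF)
  refine ⟨a, ha, majorityTendsto_of_ultrafilter fun 𝒰 h𝒰 => ?_⟩
  obtain ⟨b, -, hlim', -⟩ := h.exists_majorityTendsto hx (h𝒰.trans hF)
  suffices a = b by rwa [this]
  by_contra hab
  -- After translation by `k`, elements near the two limits are no longer close, although they are
  -- arbitrarily Floyd-close.
  obtain ⟨k, N, hN, hNW⟩ := hW.exists_disjoint a b hab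
  obtain ⟨ε, hε, hclose⟩ := hlam k
  have h1 := (hlim.smul (h.continuous_smul k)).eventually_not_majorityClose
    (hlim'.smul (h.continuous_smul k)) hN hNW hW.mk_mem
  rw [prod_map_map_eq, eventually_map] at h1
  have h2 := (eventually_floydEDist_lt z.1 hε).filter_mono
    (prod_mono (Ultrafilter.of_le F) h𝒰)
  obtain ⟨p, hp1, hp2⟩ := (h1.and h2).exists
  exact hp1 (hclose _ _ hp2)

end FloydMap

theorem mainTheorem4 {G : Type*} [Group G] (S : FiniteGeneratingSet G) (P : Set (Subgroup G))
    {T : Type*} [TopologicalSpace T] [MulAction G T]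
    (hT : IsRelHypActionWithPeripherals G T P) :
    ∃ (lam : Set.Ioo (0 : ℝ) 1) (φ : FloydBoundary S lam → bowditchBoundary G T),
      Continuous φ ∧
        ∀ (g : G) (x : FloydBoundary S lam), (φ (g • x) : T) = g • (φ x : T) := by
  have h := hT.relHyp
  have := h.t2Space
  have := h.compactSpace
  obtain ⟨x₀, x₁, x₂, h₀₁, h₀₂, h₁₂⟩ := h.three_points
  obtain ⟨x, hx⟩ : ∃ x : Fin 3 → T, Function.Injective x := by
    refine ⟨![x₀, x₁, x₂], fun i j hij => ?_⟩
    fin_cases i <;> fin_cases j <;> simp_all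
  obtain ⟨W, hW⟩ := h.exists_isExpansive
  obtain ⟨F, hF⟩ := h.exists_divider hx hW
  obtain ⟨lam, hlam⟩ := S.exists_floydEDist_lt (MajorityClose.refl x W)
    (fun _ _ hgh => hgh.symm hW.swap_mem) hF (h.finite_not_majorityClose_mul hx hW)
  choose φ hφ hlim using h.exists_majorityTendsto_floydFilter hx hW hlam
  refine ⟨lam, fun z => ⟨φ z, hφ z⟩, Continuous.subtype_mk ?_ _, fun g z => ?_⟩
  · refine continuous_iff_continuousAt.2 fun z V hV => ?_
    -- By regularity `V` contains a closed neighborhood `C` of `φ z`. A neighborhood `O` of `z`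
    -- whose trace on `G` has majorities in `C` is also a neighborhood of every nearby `y`, which
    -- forces `φ y ∈ C`.
    obtain ⟨C, hC, hCc, hCV⟩ := exists_mem_nhds_isClosed_subset hV
    obtain ⟨O, hO, hOC⟩ := mem_comap.1 (hlim z C hC)
    change ∀ᶠ y in 𝓝 z, φ y ∈ V
    filter_upwards [(continuous_subtype_val.tendsto z).eventually
      (eventually_mem_nhds_iff.2 hO)] with y hy
    refine hCV ((hlim y).mem_of_isClosed hCc ?_)
    filter_upwards [preimage_mem_comap hy] with g hg using hOC hg
  · exact ((hlim (g • z)).mono (map_mul_floydFilter_le g _)).unique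
      ((hlim z).smul (h.continuous_smul g))
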